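/- For integers $M,N,P\ge 3$ let $$A_{MNP}=\langle a,b,c\mid (a,b)_M=(b,a)_M,\ (b,c)_N=(c,b)_N,\ (c,a)_P=(a,c)_P\rangle$$ be the three-generator Artin group, where $(a,b)_M$ is the alternating word $abab\cdots$ of length $M$. Let $X_0$ be the bouquet of three loops $x,y,z$. Let $X_{1/2}$ be the graph with vertices $a,b,c$ in which each of the pairs $(a,b),(b,c),(c,a)$ is joined by two edges, one of a first and one of a second kind. Let $X_{1/4}$ be the graph with vertices $a_\pm,b_\pm,c_\pm$ and the following directed edges for the pair $(a,b)$ with loop $x$ and label $M$, and likewise for $(b,c)$ with $y,N$ and for $(c,a)$ with $z,P$: - first kind: $a_-\to b_+$, mapped to $x$, and $a_+\to b_-$, collapsed to the vertex of $X_0$; - second kind, if $M=2m+1$: $b_+\to a_+$ and $b_-\to a_-$, each mapped to $x^m$; - second kind, if $M=2m$: $b_-\to a_+$, mapped to $x^m$, and $b_+\to a_-$, mapped to $x^{m-1}$. This defines a map $X_{1/4}\to X_0$. Forgetting the signs (and keeping the kind of each edge) defines a map $X_{1/4}\to X_{1/2}$, which is a double covering. Let $A=\pi_1(X_0)$, $B=\pi_1(X_{1/2})$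 and $C=\pi_1(X_{1/4})$, where $C$ is based at any vertex of $X_{1/4}$ and $A$, $B$ at its images, and let $C\to A$ and $C\to B$ be the induced homomorphisms. Then: 1. $A\simeq F_3$, $B\simeq F_4$ and $C\simeq F_7$, the homomorphisms $C\to A$ and $C\to B$ are injective, and $[B:C]=2$. 2. $A_{MNP}\simeq A*_C B$, by an isomorphism under which the generators $x,y,z$ of $A$ correspond to $ab$, $bc$, $ca$. 3. $A_{MNP}$ has a subgroup $H$ of index two such that for every $g\in B-C$ the formula $\beta(h)=g^{-1}hg$ defines an automorphism $\beta$ of $C$, and $H$ is isomorphic to the twisted double $D(A,C,\beta)$. Here $D(A,C,\beta)$ is the free product with amalgamation $A*_C A$ in which $C$ is mapped to the first factor by the inclusion $C\hookrightarrow A$ and to the second factor by $\beta$ followed by that inclusion. -/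

import Mathlib

/-! ### Three-generator Artin groups -/

/-- The alternating word `a b a b ⋯` of length `n`. -/
def altWord {G : Type*} [Monoid G] (a b : G) : ℕ → G
  | 0 => 1
  | n + 1 => a * altWord b a n

/-- The relators `(a,b)_M (b,a)_M⁻¹`, `(b,c)_N (c,b)_N⁻¹`, `(c,a)_P (a,c)_P⁻¹`, where the generators
`a, b, c` are indexed by `0, 1, 2 : Fin 3` (addition in `Fin 3` is cyclic) and
`k = ![M, N, P]`: the edge `i` joins the generators `i` and `i + 1` and has label `k i`. -/
def artinRelators (k : Fin 3 → ℕ) : Set (FreeGroup (Fin 3)) :=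
  Set.range fun i =>
    altWord (FreeGroup.of i) (FreeGroup.of (i + 1)) (k i) *
      (altWord (FreeGroup.of (i + 1)) (FreeGroup.of i) (k i))⁻¹

/-- The three-generator Artin group with labels `k 0, k 1, k 2`. -/
abbrev ArtinTriangle (k : Fin 3 → ℕ) : Type := PresentedGroup (artinRelators k)

/-! ### Amalgamated products and twisted doubles -/

section Amalgam

universe u v

/-- The two factors of an amalgamated product, as a family. -/
def AmalgamFactor (A B : Type u) : Bool → Type u
  | false => A
  | true => B

instance AmalgamFactor.instGroup (A B : Type u) [Group A] [Group B] :
    ∀ i, Group (AmalgamFactor A B i)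
  | false => inferInstanceAs (Group A)
  | true => inferInstanceAs (Group B)

/-- The two maps of the amalgamated subgroup into the factors, as a family. -/
def amalgamMap {A B : Type u} {C : Type v} [Group A] [Group B] [Group C]
    (f : C →* A) (g : C →* B) : ∀ i, C →* AmalgamFactor A B i
  | false => f
  | true => g

/-- The pushout `A *_C B` of groups; it is the free product with amalgamation when `f` and `g`
are injective. -/
abbrev Amalgam {A B : Type u} {C : Type v} [Group A] [Group B] [Group C]
    (f : C →* A) (g : C →* B) : Type (max u v) :=
  Monoid.PushoutI (amalgamMap f g)

/-- The natural map from the first factor. -/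
def Amalgam.inl {A B : Type u} {C : Type v} [Group A] [Group B] [Group C]
    (f : C →* A) (g : C →* B) : A →* Amalgam f g :=
  Monoid.PushoutI.of (φ := amalgamMap f g) false

/-- The double `D(A, C, β)` of `A` along `C` twisted by `β`: the amalgam `A *_C A`, where `C` is
mapped to the first factor by the inclusion `f` and to the second factor by `f ∘ β`. -/
abbrev TwistedDouble {A : Type u} {C : Type v} [Group A] [Group C]
    (f : C →* A) (β : C ≃* C) : Type (max u v) :=
  Amalgam f (f.comp β.toMonoidHom)

end Amalgam

/-! ### Graphs and their fundamental groups -/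

/-- A multigraph (loops and multiple edges allowed) with vertices `V` and edges `E`, each edge with
a chosen direction. -/
structure OrGraph (V E : Type) where
  src : E → V
  tgt : E → V

namespace OrGraph

variable {V E V' E' : Type}

/-- `Γ.IsPath u L w`: the word `L` is an edge path from `u` to `w`; a letter `(e, true)` is the edge
`e` crossed along its direction, `(e, false)` is `e` crossed backwards. -/
def IsPath (Γ : OrGraph V E) : V → List (E × Bool) → V → Prop
  | u, [], w => u = w
  | u, (e, true) :: L, w => u = Γ.src e ∧ Γ.IsPath (Γ.tgt e) L w
  | u, (e, false) :: L, w => u = Γ.tgt e ∧ Γ.IsPath (Γ.src e) L w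

theorem IsPath.append {Γ : OrGraph V E} {L L' : List (E × Bool)} {u v w : V}
    (h : Γ.IsPath u L v) (h' : Γ.IsPath v L' w) : Γ.IsPath u (L ++ L') w := by
  induction L generalizing u with
  | nil => cases h; exact h'
  | cons x L ih =>
    obtain ⟨e, b⟩ := x
    cases b
    · exact ⟨h.1, ih h.2⟩
    · exact ⟨h.1, ih h.2⟩

theorem IsPath.invRev {Γ : OrGraph V E} {L : List (E × Bool)} {u w : V}
    (h : Γ.IsPath u L w) : Γ.IsPath w (FreeGroup.invRev L) u := by
  induction L generalizing u with
  | nil => cases h; exact rfl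
  | cons x L ih =>
    obtain ⟨e, b⟩ := x
    rw [FreeGroup.invRev_cons]
    cases b
    · exact (ih h.2).append ⟨rfl, h.1.symm⟩
    · exact (ih h.2).append ⟨rfl, h.1.symm⟩

/-- The fundamental group of `Γ` at `v`: closed edge paths at `v` up to insertion and deletion of
backtracks `e e⁻¹`, multiplied by concatenation. Homotopy of edge paths is equality
in the free group on `E`, so that the group is a subgroup of `FreeGroup E`. -/
def pi1 (Γ : OrGraph V E) (v : V) : Subgroup (FreeGroup E) where
  carrier := {w | ∃ L, Γ.IsPath v L v ∧ FreeGroup.mk L = w}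
  one_mem' := ⟨[], rfl, FreeGroup.one_eq_mk.symm⟩
  mul_mem' := by
    rintro _ _ ⟨L, hL, rfl⟩ ⟨L', hL', rfl⟩
    exact ⟨L ++ L', hL.append hL', FreeGroup.mul_mk.symm⟩
  inv_mem' := by
    rintro _ ⟨L, hL, rfl⟩
    exact ⟨FreeGroup.invRev L, hL.invRev, FreeGroup.inv_mk.symm⟩

/-- A map of graphs that sends vertices to vertices and each edge to an edge path (possibly of
length `0`: the edge is then collapsed). -/
structure PathMap (Γ : OrGraph V E) (Γ' : OrGraph V' E') where
  onVertex : V → V'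
  onEdge : E → List (E' × Bool)
  isPath : ∀ e, Γ'.IsPath (onVertex (Γ.src e)) (onEdge e) (onVertex (Γ.tgt e))

/-- The homomorphism on words that substitutes for each edge its image path. -/
def PathMap.onWord {Γ : OrGraph V E} {Γ' : OrGraph V' E'} (f : PathMap Γ Γ') :
    FreeGroup E →* FreeGroup E' :=
  FreeGroup.lift fun e => FreeGroup.mk (f.onEdge e)

theorem PathMap.onWord_isPath {Γ : OrGraph V E} {Γ' : OrGraph V' E'} (f : PathMap Γ Γ')
    {L : List (E × Bool)} {u w : V} (h : Γ.IsPath u L w) :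
    ∃ L', Γ'.IsPath (f.onVertex u) L' (f.onVertex w) ∧
      FreeGroup.mk L' = f.onWord (FreeGroup.mk L) := by
  induction L generalizing u with
  | nil =>
    cases h
    exact ⟨[], rfl, (map_one f.onWord).symm⟩
  | cons x L ih =>
    obtain ⟨e, b⟩ := x
    cases b
    · obtain ⟨rfl, h⟩ := h
      obtain ⟨L', hL', hw⟩ := ih h
      refine ⟨FreeGroup.invRev (f.onEdge e) ++ L', (f.isPath e).invRev.append hL', ?_⟩
      rw [← FreeGroup.mul_mk, hw, ← FreeGroup.inv_mk]
      simp [onWord]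
    · obtain ⟨rfl, h⟩ := h
      obtain ⟨L', hL', hw⟩ := ih h
      refine ⟨f.onEdge e ++ L', (f.isPath e).append hL', ?_⟩
      rw [← FreeGroup.mul_mk, hw]
      simp [onWord]

/-- The homomorphism of fundamental groups induced by a map of graphs. -/
def PathMap.pi1Map {Γ : OrGraph V E} {Γ' : OrGraph V' E'} (f : PathMap Γ Γ') (v : V) :
    Γ.pi1 v →* Γ'.pi1 (f.onVertex v) :=
  (f.onWord.comp (Γ.pi1 v).subtype).codRestrict _ (by
    rintro ⟨_, L, hL, rfl⟩
    exact f.onWord_isPath hL)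

end OrGraph

/-! ### The graphs of the splitting

The edges of the triangle are directed cyclically: edge `i` goes from generator `i` to generator
`i + 1`. A sign `+` is `true`, a sign `-` is `false`. -/

/-- `X₀`: the bouquet of three loops `x, y, z`, one for each edge of the triangle. -/
def graphX0 : OrGraph Unit (Fin 3) where
  src _ := ()
  tgt _ := ()

/-- `X_{1/2}`: the triangle with every edge doubled. For each `i` there are an edge
`inl i : i → i + 1` and an edge `inr i : i + 1 → i`. -/
def graphX12 : OrGraph (Fin 3) (Fin 3 ⊕ Fin 3) where
  src
    | .inl i => i
    | .inr i => i + 1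
  tgt
    | .inl i => i + 1
    | .inr i => i

/-- `X_{1/4}`: six vertices `i₊, i₋`. For each `i`, writing `a = i` and `b = i + 1`, it has the edges
* `inl (i, ε)`, from `a_ε` to `b_{-ε}`;
* `inr (i, ε)`, from `b_ε` to `a_ε` if `k i` is odd, and from `b_ε` to `a_{-ε}` if `k i` is even. -/
def graphX14 (k : Fin 3 → ℕ) : OrGraph (Fin 3 × Bool) ((Fin 3 × Bool) ⊕ (Fin 3 × Bool)) where
  src
    | .inl (i, ε) => (i, ε)
    | .inr (i, ε) => (i + 1, ε)
  tgt
    | .inl (i, ε) => (i + 1, !ε)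
    | .inr (i, ε) => (i, if Odd (k i) then ε else !ε)

/-- The number of times that an edge of `X_{1/4}` runs around the corresponding loop of `X₀`. With
`a = i`, `b = i + 1`: the edge from `a₊` to `b₋` of the first kind is collapsed and the one
from `a₋` to `b₊` has degree `1`. Both edges of the second kind have degree `m` if `k i = 2m + 1`; if
`k i = 2m`, the one from `b₋` to `a₊` has degree `m` and the one from `b₊` to `a₋` has degree
`m - 1`. -/
def edgeDegree (k : Fin 3 → ℕ) : (Fin 3 × Bool) ⊕ (Fin 3 × Bool) → ℕ
  | .inl (_, ε) => if ε then 0 else 1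
  | .inr (i, ε) => if Odd (k i) then k i / 2 else if ε then k i / 2 - 1 else k i / 2

/-- The triangle edge to which an edge of `X_{1/4}` belongs (its colour). -/
def edgeColour : (Fin 3 × Bool) ⊕ (Fin 3 × Bool) → Fin 3
  | .inl (i, _) => i
  | .inr (i, _) => i

theorem graphX0_isPath (L : List (Fin 3 × Bool)) (u w : Unit) : graphX0.IsPath u L w := by
  induction L generalizing u with
  | nil => exact rfl
  | cons x L ih =>
    obtain ⟨e, b⟩ := x
    cases b
    · exact ⟨rfl, ih _⟩
    · exact ⟨rfl, ih _⟩

/-- The map `X_{1/4} → X₀`: each edge of colour `i` and degree `d` runs `d` times around loop `i`. -/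
def mapX14X0 (k : Fin 3 → ℕ) : OrGraph.PathMap (graphX14 k) graphX0 where
  onVertex _ := ()
  onEdge e := List.replicate (edgeDegree k e) (edgeColour e, true)
  isPath _ := graphX0_isPath _ _ _

/-- The double covering `X_{1/4} → X_{1/2}` that forgets the signs. -/
def mapX14X12 (k : Fin 3 → ℕ) : OrGraph.PathMap (graphX14 k) graphX12 where
  onVertex v := v.1
  onEdge
    | .inl (i, _) => [(.inl i, true)]
    | .inr (i, _) => [(.inr i, true)]
  isPath := by
    rintro (⟨i, ε⟩ | ⟨i, ε⟩)
    · exact ⟨rfl, rfl⟩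
    · exact ⟨rfl, rfl⟩

/-- `A = π₁(X₀)`. -/
abbrev groupA : Type := graphX0.pi1 ()

/-- `B = π₁(X_{1/2})`, based at the image of the vertex `v` of `X_{1/4}`. -/
abbrev groupB (v : Fin 3 × Bool) : Type := graphX12.pi1 v.1

/-- `C = π₁(X_{1/4})`, based at `v`. -/
abbrev groupC (k : Fin 3 → ℕ) (v : Fin 3 × Bool) : Type := (graphX14 k).pi1 v

/-- The map `C → A`. -/
def mapCA (k : Fin 3 → ℕ) (v : Fin 3 × Bool) : groupC k v →* groupA := (mapX14X0 k).pi1Map v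

/-- The map `C → B`. -/
def mapCB (k : Fin 3 → ℕ) (v : Fin 3 × Bool) : groupC k v →* groupB v := (mapX14X12 k).pi1Map v

/-- The class in `A` of the loop `i` of `X₀`, one of `x, y, z`. -/
def loopA (i : Fin 3) : groupA :=
  ⟨FreeGroup.of i, [(i, true)], graphX0_isPath _ _ _, rfl⟩

/-! Splitting. Both groups describe the fundamental group of the mapping cylinder of `X₀ ← X_{1/4} →
X_{1/2}`. A `CylinderRep` gives values to the loops of `X₀`, the edges of `X_{1/2}` and a segment
`s(u)` for each vertex `u` of `X_{1/4}`, with one commuting square per edge of `X_{1/4}`. Put `aᵢ =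
s(i₋) s(i₊)⁻¹`. The squares of the first kind give `aᵢ aᵢ₊₁ = loop i`; eliminating the edge from the
two squares of the second kind leaves the Artin relation. The Artin group and the amalgam each carry
such a representation, and each maps to the target of any representation (for the amalgam, one with
trivial segment at the base point). The resulting maps are mutually inverse, because the `aᵢ` do not
change when the segments at a vertex of `X_{1/2}` are multiplied on the right by a common element.

Injectivity. By `PathMap.pi1Map_injective` it suffices that the target free group acts so that image
words recover the path. For `B` this is the monodromy of the covering. For `A`, contract the
collapsed edges, leaving three vertices, and subdivide an edge of degree `d` into `d` parts. The
edges of colour `i` then form one cycle of length `2m + 1`, or two of length `m`, with distinct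
vertices in distinct places, so the map to the bouquet is locally injective. `exists_perm_odd` and
`exists_perm_even` turn these cycles into permutations.

Twisted double. The sign `B → B/C` extends trivially over `A`; `H` is the kernel of this extension.
It is generated by `A` and `gAg⁻¹`, and `toAmalgam_injective` shows that they meet only in the
expected relations. -/

/-! ### Amalgams and twisted doubles -/

namespace Amalgam

universe u v w

variable {A B : Type u} {C : Type v} [Group A] [Group B] [Group C] {f : C →* A} {g : C →* B}

/-- The natural map from the second factor. -/
def inr (f : C →* A) (g : C →* B) : B →* Amalgam f g :=
  Monoid.PushoutI.of (φ := amalgamMap f g) true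

theorem inl_eq_inr (c : C) : inl f g (f c) = inr f g (g c) :=
  (Monoid.PushoutI.of_apply_eq_base (amalgamMap f g) false c).trans
    (Monoid.PushoutI.of_apply_eq_base (amalgamMap f g) true c).symm

/-- The universal property of the amalgam. -/
def lift {G : Type w} [Group G] (p : A →* G) (q : B →* G) (h : ∀ c, p (f c) = q (g c)) :
    Amalgam f g →* G :=
  Monoid.PushoutI.lift (φ := amalgamMap f g)
    (fun i => match i with
      | false => p
      | true => q)
    (q.comp g)
    (fun i => match i with
      | false => MonoidHom.ext h
      | true => rfl)

@[simp]
theorem lift_inl {G : Type w} [Group G] (p : A →* G) (q : B →* G) (h : ∀ c, p (f c) = q (g c))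
    (a : A) : lift p q h (inl f g a) = p a :=
  Monoid.PushoutI.lift_of (φ := amalgamMap f g) (i := false) _ _ _ a

@[simp]
theorem lift_inr {G : Type w} [Group G] (p : A →* G) (q : B →* G) (h : ∀ c, p (f c) = q (g c))
    (b : B) : lift p q h (inr f g b) = q b :=
  Monoid.PushoutI.lift_of (φ := amalgamMap f g) (i := true) _ _ _ b

theorem induction {motive : Amalgam f g → Prop} (hl : ∀ a, motive (inl f g a))
    (hr : ∀ b, motive (inr f g b)) (hm : ∀ x y, motive x → motive y → motive (x * y))
    (x : Amalgam f g) : motive x := by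
  induction x using Monoid.PushoutI.induction_on with
  | of i a =>
    cases i
    · exact hl a
    · exact hr a
  | base c =>
    rw [← Monoid.PushoutI.of_apply_eq_base (amalgamMap f g) false c]
    exact hl _
  | mul x y hx hy => exact hm x y hx hy

theorem hom_ext {G : Type w} [Group G] {p q : Amalgam f g →* G}
    (hl : ∀ a, p (inl f g a) = q (inl f g a)) (hr : ∀ b, p (inr f g b) = q (inr f g b)) :
    p = q := by
  refine MonoidHom.ext fun x => ?_
  induction x using induction with
  | hl a => exact hl a
  | hr b => exact hr b
  | hm x y hx hy => rw [map_mul, map_mul, hx, hy]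

end Amalgam

/-! ### The sign kernel of an amalgam as a twisted double -/

namespace TwistedDouble

open Amalgam

variable {A B C : Type} [Group A] [Group B] [Group C] {f : C →* A} {i : C →* B} {χ : B →* ℤˣ}

/-- The homomorphism to `ℤˣ` that is trivial on the first factor and given by `χ` on the second
one. -/
def sign (f : C →* A) (hχ : i.range = χ.ker) : Amalgam f i →* ℤˣ :=
  Amalgam.lift 1 χ fun c => by
    have : i c ∈ χ.ker := hχ ▸ ⟨c, rfl⟩
    exact (MonoidHom.mem_ker.mp this).symm

variable {g : B} {β : C ≃* C}

/-- The map to the amalgam that is the inclusion on the first factor and the inclusion followed by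
conjugation by `g` on the second one. -/
def toAmalgam (f : C →* A) (hβ : ∀ c, i (β c) = g⁻¹ * i c * g) :
    TwistedDouble f β →* Amalgam f i :=
  Amalgam.lift (inl f i) ((MulAut.conj (inr f i g)).toMonoidHom.comp (inl f i)) fun c => by
    change _ = inr f i g * inl f i (f (β c)) * (inr f i g)⁻¹
    rw [inl_eq_inr, inl_eq_inr, hβ, ← map_inv, ← map_mul, ← map_mul]
    congr 1
    group

theorem toAmalgam_inl (hβ : ∀ c, i (β c) = g⁻¹ * i c * g) (a : A) :
    toAmalgam f hβ (inl f (f.comp β.toMonoidHom) a) = inl f i a :=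
  lift_inl _ _ _ _

theorem toAmalgam_inr (hβ : ∀ c, i (β c) = g⁻¹ * i c * g) (a : A) :
    toAmalgam f hβ (inr f (f.comp β.toMonoidHom) a) =
      inr f i g * inl f i a * (inr f i g)⁻¹ :=
  lift_inr _ _ _ _

theorem eq_neg_one_of_notMem (hχ : i.range = χ.ker) (hg : g ∉ i.range) : χ g = -1 := by
  rw [hχ, MonoidHom.mem_ker] at hg
  exact (Int.units_eq_one_or (χ g)).resolve_left hg

/-- Since `g² ∈ C`, the subgroup generated by `A` and `gAg⁻¹` is stable under conjugation by `g`. It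
and its translate by `g` therefore cover the amalgam, and the sign separates the two. -/
theorem range_toAmalgam (hχ : i.range = χ.ker) (hg : g ∉ i.range)
    (hβ : ∀ c, i (β c) = g⁻¹ * i c * g) : (toAmalgam f hβ).range = (sign f hχ).ker := by
  have hχg := eq_neg_one_of_notMem hχ hg
  apply le_antisymm
  · rintro _ ⟨x, rfl⟩
    rw [MonoidHom.mem_ker]
    induction x using Amalgam.induction with
    | hl a => rw [toAmalgam_inl]; exact lift_inl _ _ _ _
    | hr a =>
      rw [toAmalgam_inr]
      simp [sign]
    | hm x y hx hy => rw [map_mul, map_mul, hx, hy, one_mul]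
  · have hA : ∀ a, inl f i a ∈ (toAmalgam f hβ).range := fun a => ⟨_, toAmalgam_inl hβ a⟩
    have hC : ∀ b, χ b = 1 → inr f i b ∈ (toAmalgam f hβ).range := by
      intro b hb
      obtain ⟨c, rfl⟩ : b ∈ i.range := hχ ▸ hb
      rw [← inl_eq_inr]
      exact hA _
    have hconj : ∀ x ∈ (toAmalgam f hβ).range,
        inr f i g * x * (inr f i g)⁻¹ ∈ (toAmalgam f hβ).range := by
      rintro _ ⟨x, rfl⟩
      induction x using Amalgam.induction with
      | hl a => exact ⟨_, toAmalgam_inr hβ a⟩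
      | hr a =>
        rw [toAmalgam_inr]
        have : inr f i g * (inr f i g * inl f i a * (inr f i g)⁻¹) * (inr f i g)⁻¹ =
            inr f i (g * g) * inl f i a * (inr f i (g * g))⁻¹ := by
          rw [map_mul]; group
        rw [this]
        have h2 := hC (g * g) (by rw [map_mul, hχg]; rfl)
        exact mul_mem (mul_mem h2 (hA a)) (inv_mem h2)
      | hm x y hx hy =>
        rw [map_mul]
        convert mul_mem hx hy using 1
        group
    have key : ∀ x : Amalgam f i, x ∈ (toAmalgam f hβ).range ∨
        (inr f i g)⁻¹ * x ∈ (toAmalgam f hβ).range := by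
      -- Conjugation by `g⁻¹` is obtained as `g⁻¹xg = g⁻²(gxg⁻¹)g²`, with `g² ∈ C`.
      have step : ∀ x y : Amalgam f i, y ∈ (toAmalgam f hβ).range →
          x ∈ (toAmalgam f hβ).range → (inr f i g)⁻¹ * (x * (inr f i g * y)) ∈
            (toAmalgam f hβ).range := by
        intro x y hy hx
        have h2 := hC (g * g) (by rw [map_mul, hχg]; rfl)
        have := mul_mem (mul_mem (mul_mem (inv_mem h2) (hconj x hx)) h2) hy
        rw [map_mul] at this
        convert this using 1
        group
      intro x
      induction x using Amalgam.induction with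
      | hl a => exact .inl (hA a)
      | hr b =>
        rcases Int.units_eq_one_or (χ b) with hb | hb
        · exact .inl (hC b hb)
        · refine .inr ?_
          rw [← map_inv, ← map_mul]
          exact hC _ (by rw [map_mul, map_inv, hb, hχg]; rfl)
      | hm x y hx hy =>
        rcases hx with hx | hx <;> rcases hy with hy | hy
        · exact .inl (mul_mem hx hy)
        · refine .inr ?_
          simpa using step x _ hy hx
        · refine .inr ?_
          rw [← mul_assoc]
          exact mul_mem hx hy
        · refine .inl ?_
          have h2 := hC (g * g) (by rw [map_mul, hχg]; rfl)
          have := mul_mem h2 (step _ _ hy hx)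
          rw [map_mul] at this
          convert this using 1
          group
    intro x hx
    refine (key x).resolve_right fun h => ?_
    have hle : ∀ y ∈ (toAmalgam f hβ).range, sign f hχ y = 1 := by
      rintro _ ⟨y, rfl⟩
      induction y using Amalgam.induction with
      | hl a => rw [toAmalgam_inl]; exact lift_inl _ _ _ _
      | hr a =>
        rw [toAmalgam_inr]
        simp [sign]
      | hm x y hx hy => rw [map_mul, map_mul, hx, hy, one_mul]
    have h1 := hle _ h
    rw [map_mul, MonoidHom.mem_ker.mp hx, map_inv, mul_one] at h1
    have h2 : sign f hχ (inr f i g) = χ g := lift_inr _ _ _ _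
    rw [h2, hχg] at h1
    exact absurd h1 (by decide)

/-- Representatives `1` and `g⁻¹` of the cosets of the kernel of `χ`. -/
def cosetRep (g : B) (u : ℤˣ) : B := if u = 1 then 1 else g⁻¹

theorem sign_cosetRep (hχg : χ g = -1) (u : ℤˣ) : χ (cosetRep g u) = u := by
  rcases Int.units_eq_one_or u with rfl | rfl
  · simp [cosetRep]
  · simp [cosetRep, hχg]

/-- The Schreier cocycle of `C` in `B`, which serves to induce actions from index two. -/
theorem exists_cocycle (hχ : i.range = χ.ker) (hχg : χ g = -1) (b : B) (u : ℤˣ) :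
    ∃ c, i c = (cosetRep g (χ b * u))⁻¹ * b * cosetRep g u := by
  have : (cosetRep g (χ b * u))⁻¹ * b * cosetRep g u ∈ χ.ker := by
    rw [MonoidHom.mem_ker, map_mul, map_mul, map_inv, sign_cosetRep hχg, sign_cosetRep hχg,
      mul_assoc, inv_mul_cancel]
  rwa [← hχ] at this

/-- The left regular action of the double is induced up to the amalgam, on two sheets `D × ℤˣ`: `A`
acts through the first factor on one sheet and the second factor on the other, and `B` acts through
the cocycle. Restricted to the double, sheet `1` is the regular action again, which is faithful. -/
theorem toAmalgam_injective (hi : Function.Injective i) (hχ : i.range = χ.ker)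
    (hg : g ∉ i.range) (hβ : ∀ c, i (β c) = g⁻¹ * i c * g) :
    Function.Injective (toAmalgam f hβ) := by
  have hχg := eq_neg_one_of_notMem hχ hg
  choose κ hκ using exists_cocycle hχ hχg
  have hκ_one : ∀ u, κ 1 u = 1 := fun u => hi (by rw [hκ]; simp)
  have hκ_mul : ∀ b b' u, κ (b * b') u = κ b (χ b' * u) * κ b' u := fun b b' u => hi (by
    rw [map_mul, hκ, hκ, hκ, map_mul, mul_assoc (χ b)]
    group)
  set D := TwistedDouble f β
  let l : A →* D := inl f (f.comp β.toMonoidHom)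
  let r : A →* D := inr f (f.comp β.toMonoidHom)
  have hlr : ∀ c, l (f c) = r (f (β c)) := fun c => inl_eq_inr c
  let actA : A →* Equiv.Perm (D × ℤˣ) :=
    { toFun := fun a =>
        { toFun := fun x => ((if x.2 = 1 then l a else r a) * x.1, x.2)
          invFun := fun x => ((if x.2 = 1 then l a else r a)⁻¹ * x.1, x.2)
          left_inv := fun x => Prod.ext (inv_mul_cancel_left _ _) rfl
          right_inv := fun x => Prod.ext (mul_inv_cancel_left _ _) rfl }
      map_one' := by ext1 x; simp
      map_mul' := fun a a' => by
        ext1 x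
        by_cases h : x.2 = 1 <;> simp [h, mul_assoc] }
  let actB : B →* Equiv.Perm (D × ℤˣ) :=
    MonoidHom.toHomPerm
    { toFun := fun b x => (l (f (κ b x.2)) * x.1, χ b * x.2)
      map_one' := by funext x; simp [hκ_one]; rfl
      map_mul' := fun b b' => by
        funext x
        change _ = (_, _)
        simp [hκ_mul, mul_assoc] }
  have hker : ∀ c, χ (i c) = 1 := fun c => by
    have : i c ∈ χ.ker := hχ ▸ ⟨c, rfl⟩
    exact this
  have compat : ∀ c, actA (f c) = actB (i c) := by
    intro c
    ext1 ⟨d, u⟩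
    change ((if u = 1 then l (f c) else r (f c)) * d, u) = (l (f (κ (i c) u)) * d, χ (i c) * u)
    rw [hker, one_mul]
    congr 2
    rcases Int.units_eq_one_or u with rfl | rfl
    · rw [if_pos rfl]
      congr 2
      apply hi
      rw [hκ, hker]
      simp [cosetRep]
    · rw [if_neg (by decide), hlr]
      congr 2
      apply hi
      rw [hβ, hκ, hker, one_mul]
      have : cosetRep g (-1) = g⁻¹ := if_neg (by decide)
      rw [this]
      group
  let act : Amalgam f i →* Equiv.Perm (D × ℤˣ) := Amalgam.lift actA actB compat
  have hone : cosetRep g 1 = 1 := if_pos rfl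
  have hneg : cosetRep g (-1) = g⁻¹ := if_neg (by decide)
  -- The representative `g⁻¹` makes `g` carry sheet `-1` to sheet `1` without holonomy, so `gag⁻¹`
  -- acts on sheet `1` as `a` acts on sheet `-1`.
  have hact_g : ∀ d, actB g (d, -1) = (d, 1) := by
    intro d
    change (l (f (κ g (-1))) * d, χ g * -1) = _
    have : κ g (-1) = 1 := hi (by
      rw [hκ, hχg, hneg, show (-1 : ℤˣ) * -1 = 1 from rfl, hone]
      simp)
    rw [this, hχg]
    simp
  have main : ∀ x d, act (toAmalgam f hβ x) (d, 1) = (x * d, 1) := by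
    intro x
    induction x using Amalgam.induction with
    | hl a =>
      intro d
      rw [toAmalgam_inl, Amalgam.lift_inl]
      change ((if (1 : ℤˣ) = 1 then l a else r a) * d, (1 : ℤˣ)) = _
      rw [if_pos rfl]
    | hr a =>
      intro d
      rw [toAmalgam_inr, map_mul, map_mul, map_inv, Amalgam.lift_inl, Amalgam.lift_inr,
        Equiv.Perm.mul_apply, Equiv.Perm.mul_apply, ← hact_g d,
        show (actB g)⁻¹ (actB g (d, -1)) = (d, -1) from (actB g).symm_apply_apply _]
      change actB g ((if (-1 : ℤˣ) = 1 then l a else r a) * d, (-1 : ℤˣ)) = _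
      rw [if_neg (by decide), hact_g]
    | hm x y hx hy =>
      intro d
      rw [map_mul, map_mul, Equiv.Perm.mul_apply, hy, hx, mul_assoc]
  intro x y hxy
  have := main x 1
  rw [hxy, main y 1] at this
  simpa using (congrArg Prod.fst this).symm

theorem exists_mulEquiv (hi : Function.Injective i) (hχ : i.range = χ.ker) (hg : g ∉ i.range) :
    ∃ β : C ≃* C, (∀ c, i (β c) = g⁻¹ * i c * g) ∧
      Nonempty (TwistedDouble f β ≃* (sign f hχ).ker) := by
  have hn : i.range.Normal := hχ ▸ MonoidHom.normal_ker χ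
  let ε := MonoidHom.ofInjective hi
  let β : C ≃* C := (ε.trans (MulAut.conjNormal g⁻¹)).trans ε.symm
  have hβ : ∀ c, i (β c) = g⁻¹ * i c * g := by
    intro c
    have h : ε (β c) = MulAut.conjNormal g⁻¹ (ε c) := ε.apply_symm_apply _
    have h' := congrArg Subtype.val h
    rw [MulAut.conjNormal_apply, inv_inv] at h'
    exact h'
  exact ⟨β, hβ, ⟨(MonoidHom.ofInjective (toAmalgam_injective hi hχ hg hβ)).trans
    (MulEquiv.subgroupCongr (range_toAmalgam hχ hg hβ))⟩⟩

end TwistedDouble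

/-! ### Edge paths and spanning trees -/

namespace OrGraph

variable {V E V' E' : Type} {Γ : OrGraph V E} {Γ' : OrGraph V' E'}

/-- `Γ.Connects u w x`: the element `x` of the free group on the edges is the class of an edge path
from `u` to `w`. -/
def Connects (Γ : OrGraph V E) (u w : V) (x : FreeGroup E) : Prop :=
  ∃ L, Γ.IsPath u L w ∧ FreeGroup.mk L = x

namespace Connects

variable {u v w : V} {x y : FreeGroup E}

theorem refl (Γ : OrGraph V E) (u : V) : Γ.Connects u u 1 :=
  ⟨[], rfl, FreeGroup.one_eq_mk.symm⟩

theorem mul (hx : Γ.Connects u v x) (hy : Γ.Connects v w y) : Γ.Connects u w (x * y) := by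
  obtain ⟨L, hL, rfl⟩ := hx
  obtain ⟨L', hL', rfl⟩ := hy
  exact ⟨L ++ L', hL.append hL', FreeGroup.mul_mk.symm⟩

theorem inv (hx : Γ.Connects u w x) : Γ.Connects w u x⁻¹ := by
  obtain ⟨L, hL, rfl⟩ := hx
  exact ⟨FreeGroup.invRev L, hL.invRev, FreeGroup.inv_mk.symm⟩

theorem of (Γ : OrGraph V E) (e : E) : Γ.Connects (Γ.src e) (Γ.tgt e) (FreeGroup.of e) :=
  ⟨[(e, true)], ⟨rfl, rfl⟩, rfl⟩

theorem map (f : PathMap Γ Γ') (h : Γ.Connects u w x) :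
    Γ'.Connects (f.onVertex u) (f.onVertex w) (f.onWord x) := by
  obtain ⟨L, hL, rfl⟩ := h
  exact f.onWord_isPath hL

theorem induction {motive : V → V → FreeGroup E → Prop} (refl : ∀ u, motive u u 1)
    (edge : ∀ e w x, motive (Γ.tgt e) w x → motive (Γ.src e) w (FreeGroup.of e * x))
    (edge_inv : ∀ e w x, motive (Γ.src e) w x → motive (Γ.tgt e) w ((FreeGroup.of e)⁻¹ * x))
    (h : Γ.Connects u w x) : motive u w x := by
  obtain ⟨L, hL, rfl⟩ := h
  induction L generalizing u with
  | nil =>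
    cases hL
    exact refl _
  | cons a L ih =>
    obtain ⟨e, b⟩ := a
    cases b
    · obtain ⟨rfl, hL⟩ := hL
      exact edge_inv _ _ _ (ih hL)
    · obtain ⟨rfl, hL⟩ := hL
      exact edge _ _ _ (ih hL)

/-- Two homomorphisms that are intertwined on edges by a family of group elements indexed by the
vertices are intertwined on paths. -/
theorem intertwine {G : Type*} [Group G] (s : V → G) (F F' : FreeGroup E →* G)
    (hs : ∀ e, s (Γ.src e) * F (FreeGroup.of e) = F' (FreeGroup.of e) * s (Γ.tgt e))
    (h : Γ.Connects u w x) : s u * F x = F' x * s w := by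
  refine Connects.induction (motive := fun u w x => s u * F x = F' x * s w) (fun u => by simp)
    (fun e w x ih => ?_) (fun e w x ih => ?_) h
  · rw [map_mul, map_mul, ← mul_assoc, hs, mul_assoc, ih, mul_assoc]
  · have : s (Γ.tgt e) * (F (FreeGroup.of e))⁻¹ = (F' (FreeGroup.of e))⁻¹ * s (Γ.src e) := by
      rw [mul_inv_eq_iff_eq_mul, mul_assoc, hs, inv_mul_cancel_left]
    rw [map_mul, map_mul, map_inv, map_inv, mul_assoc, ← ih, ← mul_assoc, this, mul_assoc]

end Connects

theorem PathMap.onWord_of (f : PathMap Γ Γ') (e : E) :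
    f.onWord (FreeGroup.of e) = FreeGroup.mk (f.onEdge e) :=
  FreeGroup.lift_apply_of

/-! ### Bases of fundamental groups from spanning trees -/

section Retraction

variable {v : V} (t : V → FreeGroup E) (ht : ∀ u, Γ.Connects v u (t u))

/-- The retraction of the free group on the edges onto the fundamental group that is given by the
choice of a path from the base point to every vertex. -/
def retraction : FreeGroup E →* Γ.pi1 v :=
  FreeGroup.lift fun e =>
    ⟨t (Γ.src e) * FreeGroup.of e * (t (Γ.tgt e))⁻¹, ((ht _).mul (.of Γ e)).mul (ht _).inv⟩

theorem retraction_of (e : E) : (retraction t ht (FreeGroup.of e) : FreeGroup E) =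
    t (Γ.src e) * FreeGroup.of e * (t (Γ.tgt e))⁻¹ :=
  congrArg Subtype.val FreeGroup.lift_apply_of

theorem retraction_of_connects {u w : V} {x : FreeGroup E} (h : Γ.Connects u w x) :
    (retraction t ht x : FreeGroup E) = t u * x * (t w)⁻¹ := by
  refine eq_mul_inv_of_mul_eq (h.intertwine t (.id _)
    ((Γ.pi1 v).subtype.comp (retraction t ht)) fun e => ?_).symm
  change _ = (retraction t ht (FreeGroup.of e) : FreeGroup E) * _
  rw [retraction_of, inv_mul_cancel_right]
  rfl

theorem retraction_coe (h1 : t v = 1) (x : Γ.pi1 v) : retraction t ht x = x :=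
  Subtype.ext (by rw [retraction_of_connects t ht x.2, h1]; simp)

/-- If the chosen paths run in a tree, the edges outside the tree give a basis of the fundamental
group. -/
def pi1EquivFreeGroup {I : Type} (h1 : t v = 1) (ε : I → E) (κ : FreeGroup E →* FreeGroup I)
    (hκε : ∀ i, κ (FreeGroup.of (ε i)) = FreeGroup.of i) (hκt : ∀ u, κ (t u) = 1)
    (hE : ∀ e, (∃ i, ε i = e) ∨
      κ (FreeGroup.of e) = 1 ∧ t (Γ.src e) * FreeGroup.of e = t (Γ.tgt e)) :
    Γ.pi1 v ≃* FreeGroup I :=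
  MonoidHom.toMulEquiv (κ.comp (Γ.pi1 v).subtype)
    (FreeGroup.lift fun i => retraction t ht (FreeGroup.of (ε i)))
    (by
      set ψ : FreeGroup I →* Γ.pi1 v :=
        FreeGroup.lift fun i => retraction t ht (FreeGroup.of (ε i)) with hψ
      have : ψ.comp κ = retraction t ht := by
        refine FreeGroup.ext_hom _ _ fun e => ?_
        rcases hE e with ⟨i, rfl⟩ | ⟨h, h'⟩
        · rw [MonoidHom.comp_apply, hκε, hψ, FreeGroup.lift_apply_of]
        · rw [MonoidHom.comp_apply, h, map_one]
          refine Subtype.ext ?_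
          rw [retraction_of, h', mul_inv_cancel]
          rfl
      refine MonoidHom.ext fun x => ?_
      exact (DFunLike.congr_fun this (x : FreeGroup E)).trans (retraction_coe t ht h1 x))
    (by
      refine FreeGroup.ext_hom _ _ fun i => ?_
      rw [MonoidHom.comp_apply, FreeGroup.lift_apply_of]
      change κ (retraction t ht (FreeGroup.of (ε i)) : FreeGroup E) = _
      rw [retraction_of, map_mul, map_mul, map_inv, hκt, hκt, hκε]
      simp)

end Retraction

/-- A map of graphs is injective on fundamental groups if its image words act on a set in such a
way that the image of an edge path moves a point by that path. -/
theorem PathMap.pi1Map_injective (f : PathMap Γ Γ') {X : Type*}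
    (Θ : FreeGroup E' →* Equiv.Perm X) (j : V → FreeGroup E → X)
    (h : ∀ e y, Θ (f.onWord (FreeGroup.of e)) (j (Γ.tgt e) y) = j (Γ.src e) (FreeGroup.of e * y))
    {v : V} (hj : Function.Injective (j v)) : Function.Injective (f.pi1Map v) := by
  have key : ∀ {u w x}, Γ.Connects u w x → ∀ y, Θ (f.onWord x) (j w y) = j u (x * y) := by
    intro u w x hx
    refine hx.induction (motive := fun u w x => ∀ y, Θ (f.onWord x) (j w y) = j u (x * y))
      (fun u y => by simp) (fun e w x ih y => ?_) (fun e w x ih y => ?_)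
    · rw [map_mul, map_mul, Equiv.Perm.mul_apply, ih, h, mul_assoc]
    · rw [map_mul, map_mul, Equiv.Perm.mul_apply, ih, map_inv, map_inv, Equiv.Perm.inv_eq_iff_eq,
        h, mul_assoc, mul_inv_cancel_left]
  refine (injective_iff_map_eq_one _).mpr fun x hx => ?_
  have hx' : f.onWord (x : FreeGroup E) = 1 := congrArg Subtype.val hx
  have := key x.2 1
  rw [hx', map_one, mul_one] at this
  exact Subtype.ext (hj this).symm

/-! ### Graphs with a Hamiltonian cycle -/

section Cycle

/-- The path of length `n` from `v` along the edges `inl u : u → next u`. -/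
def cyclePath (next : V → V) (v : V) : ℕ → FreeGroup (V ⊕ V)
  | 0 => 1
  | n + 1 => cyclePath next v n * FreeGroup.of (.inl (next^[n] v))

variable {Γ : OrGraph V (V ⊕ V)} {next : V → V}

theorem connects_cyclePath (hsrc : ∀ u, Γ.src (.inl u) = u) (htgt : ∀ u, Γ.tgt (.inl u) = next u)
    (v : V) (n : ℕ) : Γ.Connects v (next^[n] v) (cyclePath next v n) := by
  induction n with
  | zero => exact .refl Γ v
  | succ n ih =>
    refine ih.mul ?_
    rw [Function.iterate_succ_apply']
    simpa only [hsrc, htgt] using Connects.of Γ (.inl (next^[n] v))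

theorem map_cyclePath_eq_one {v : V} {G : Type*} [Group G] (κ : FreeGroup (V ⊕ V) →* G)
    (hκ : ∀ u, next u ≠ v → κ (FreeGroup.of (.inl u)) = 1) {n : ℕ}
    (hn : ∀ m ≤ n, next^[m] v = v → m = 0) : κ (cyclePath next v n) = 1 := by
  induction n with
  | zero => exact map_one κ
  | succ n ih =>
    rw [cyclePath, map_mul, ih fun m hm => hn m (hm.trans n.le_succ), one_mul]
    refine hκ _ fun h => ?_
    rw [← Function.iterate_succ_apply' next] at h
    exact absurd (hn _ le_rfl h) n.succ_ne_zero

variable [DecidableEq V] {v : V} (hv : ∀ u, ∃ n, next^[n] v = u)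

/-- The shortest path to `u` along the edges `inl`. -/
def treePath (u : V) : FreeGroup (V ⊕ V) := cyclePath next v (Nat.find (hv u))

theorem connects_treePath (hsrc : ∀ u, Γ.src (.inl u) = u) (htgt : ∀ u, Γ.tgt (.inl u) = next u)
    (u : V) : Γ.Connects v u (treePath hv u) := by
  have := connects_cyclePath hsrc htgt v (Nat.find (hv u))
  rwa [Nat.find_spec (hv u)] at this

theorem treePath_base : treePath hv v = 1 := by
  have : Nat.find (hv v) = 0 := (Nat.find_eq_zero _).mpr rfl
  rw [treePath, this]
  rfl

theorem treePath_next (hinj : Function.Injective next) {u : V} (hu : next u ≠ v) :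
    treePath hv u * FreeGroup.of (.inl u) = treePath hv (next u) := by
  have h : Nat.find (hv (next u)) = Nat.find (hv u) + 1 := by
    refine (Nat.find_eq_iff _).mpr ⟨?_, fun n hn h => ?_⟩
    · rw [Function.iterate_succ_apply', Nat.find_spec (hv u)]
    · cases n with
      | zero => exact hu h.symm
      | succ n =>
        rw [Function.iterate_succ_apply'] at h
        exact Nat.find_min (hv u) (Nat.lt_of_succ_lt_succ hn) (hinj h)
  rw [treePath, treePath, h, cyclePath, Nat.find_spec (hv u)]

/-- The fundamental group of a graph in which half of the edges form an oriented Hamiltonian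
cycle. -/
theorem nonempty_pi1_mulEquiv (hsrc : ∀ u, Γ.src (.inl u) = u)
    (htgt : ∀ u, Γ.tgt (.inl u) = next u) (hinj : Function.Injective next)
    (hv : ∀ u, ∃ n, next^[n] v = u) {last : V} (hlast : next last = v) :
    Nonempty (Γ.pi1 v ≃* FreeGroup (Option V)) := by
  let κ : FreeGroup (V ⊕ V) →* FreeGroup (Option V) := FreeGroup.lift fun e => match e with
    | .inl u => if next u = v then FreeGroup.of none else 1
    | .inr u => FreeGroup.of (some u)
  have hκl : ∀ u, κ (FreeGroup.of (.inl u)) = if next u = v then FreeGroup.of none else 1 :=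
    fun u => FreeGroup.lift_apply_of
  have hκr : ∀ u, κ (FreeGroup.of (.inr u)) = FreeGroup.of (some u) :=
    fun u => FreeGroup.lift_apply_of
  -- The cycle without its last edge is a spanning tree; the basis is that closing edge and all
  -- edges `inr`.
  let ε : Option V → V ⊕ V := fun o => match o with
    | none => .inl last
    | some u => .inr u
  refine ⟨pi1EquivFreeGroup (treePath hv) (connects_treePath hv hsrc htgt) (treePath_base hv) ε κ
    ?_ ?_ ?_⟩
  · rintro (_ | u)
    · rw [hκl, if_pos hlast]
    · exact hκr u
  · intro u
    refine map_cyclePath_eq_one κ (fun u hu => by rw [hκl, if_neg hu]) fun m hm h => ?_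
    by_contra hm0
    have hp : next^[Nat.find (hv u) - m] v = u := by
      have := Nat.find_spec (hv u)
      rwa [show Nat.find (hv u) = (Nat.find (hv u) - m) + m by omega,
        Function.iterate_add_apply, h] at this
    exact Nat.find_min (hv u) (by omega) hp
  · rintro (u | u)
    · by_cases hu : next u = v
      · exact .inl ⟨none, by rw [← hlast] at hu; rw [hinj hu]⟩
      · refine .inr ⟨by rw [hκl, if_neg hu], ?_⟩
        rw [hsrc, htgt]
        exact treePath_next hv hinj hu
    · exact .inl ⟨some u, rfl⟩

end Cycle

end OrGraph

/-! ### The three graphs -/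

open OrGraph

theorem pi1_graphX0 : graphX0.pi1 () = ⊤ :=
  eq_top_iff.mpr fun x _ => ⟨x.toWord, graphX0_isPath _ _ _, FreeGroup.mk_toWord⟩

/-- `A` is the free group on the loops. -/
def groupAEquiv : groupA ≃* FreeGroup (Fin 3) :=
  (MulEquiv.subgroupCongr pi1_graphX0).trans Subgroup.topEquiv

theorem groupAEquiv_symm_of (i : Fin 3) : groupAEquiv.symm (FreeGroup.of i) = loopA i :=
  groupAEquiv.symm_apply_eq.mpr rfl

/-- The successor of a vertex of `X_{1/2}` along the edges of the first kind. -/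
def next12 (u : Fin 3) : Fin 3 := u + 1

/-- The successor of a vertex of `X_{1/4}` along the edges of the first kind. -/
def next14 (u : Fin 3 × Bool) : Fin 3 × Bool := (u.1 + 1, !u.2)

theorem next12_injective : Function.Injective next12 := by decide

theorem next14_injective : Function.Injective next14 := by decide

theorem exists_iterate_next12 (v u : Fin 3) : ∃ n, next12^[n] v = u := by
  have : ∀ v u, ∃ n : Fin 3, next12^[n.1] v = u := by decide
  exact ⟨_, (this v u).choose_spec⟩

theorem exists_iterate_next14 (v u : Fin 3 × Bool) : ∃ n, next14^[n] v = u := by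
  have : ∀ v u, ∃ n : Fin 6, next14^[n.1] v = u := by decide
  exact ⟨_, (this v u).choose_spec⟩

theorem nonempty_groupB_mulEquiv (v : Fin 3 × Bool) :
    Nonempty (groupB v ≃* FreeGroup (Fin 4)) := by
  have hv : ∀ v, ∃ u, next12 u = v := by decide
  obtain ⟨e⟩ := nonempty_pi1_mulEquiv (Γ := graphX12) (fun _ => rfl) (fun _ => rfl)
    next12_injective (exists_iterate_next12 v.1) (hv v.1).choose_spec
  exact ⟨e.trans (FreeGroup.freeGroupCongr (Fintype.equivFinOfCardEq (by decide)))⟩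

theorem nonempty_groupC_mulEquiv (k : Fin 3 → ℕ) (v : Fin 3 × Bool) :
    Nonempty (groupC k v ≃* FreeGroup (Fin 7)) := by
  have hv : ∀ v, ∃ u, next14 u = v := by decide
  obtain ⟨e⟩ := nonempty_pi1_mulEquiv (Γ := graphX14 k) (fun _ => rfl) (fun _ => rfl)
    next14_injective (exists_iterate_next14 v) (hv v).choose_spec
  exact ⟨e.trans (FreeGroup.freeGroupCongr (Fintype.equivFinOfCardEq (by decide)))⟩

/-! ### The double covering and the index of `C` in `B` -/

section DoubleCover

variable (k : Fin 3 → ℕ)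

theorem mapX14X12_onWord_inl (i : Fin 3) (ε : Bool) :
    (mapX14X12 k).onWord (FreeGroup.of (.inl (i, ε))) = FreeGroup.of (.inl i) :=
  PathMap.onWord_of _ _

theorem mapX14X12_onWord_inr (i : Fin 3) (ε : Bool) :
    (mapX14X12 k).onWord (FreeGroup.of (.inr (i, ε))) = FreeGroup.of (.inr i) :=
  PathMap.onWord_of _ _

/-- The sign change along an edge of the second kind. -/
def signChange (i : Fin 3) : Equiv.Perm Bool :=
  if Odd (k i) then 1 else Equiv.boolNot

theorem signChange_apply (i : Fin 3) (ε : Bool) :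
    signChange k i ε = if Odd (k i) then ε else !ε := by
  unfold signChange
  split_ifs <;> rfl

theorem signChange_signChange (i : Fin 3) (ε : Bool) :
    signChange k i (signChange k i ε) = ε := by
  rw [signChange_apply, signChange_apply]
  split_ifs <;> simp

theorem mapCB_injective (v : Fin 3 × Bool) : Function.Injective (mapCB k v) := by
  let F := FreeGroup ((Fin 3 × Bool) ⊕ (Fin 3 × Bool))
  -- Monodromy on signs, recording the lifted edge; an edge moves the sign at its target to the sign
  -- at its source.
  let Θ : FreeGroup (Fin 3 ⊕ Fin 3) →* Equiv.Perm (Bool × F) := FreeGroup.lift fun e => match e with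
    | .inl i => Equiv.prodShear Equiv.boolNot fun ε =>
        Equiv.mulLeft (FreeGroup.of (.inl (i, !ε)))
    | .inr i => Equiv.prodShear (signChange k i) fun ε =>
        Equiv.mulLeft (FreeGroup.of (.inr (i, signChange k i ε)))
  refine (mapX14X12 k).pi1Map_injective Θ (fun u y => (u.2, y)) ?_ (Prod.mk_right_injective v.2)
  rintro (⟨i, ε⟩ | ⟨i, ε⟩) y
  · rw [mapX14X12_onWord_inl, FreeGroup.lift_apply_of]
    cases ε <;> rfl
  · rw [mapX14X12_onWord_inr, FreeGroup.lift_apply_of]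
    change (signChange k i (if Odd (k i) then ε else !ε),
      FreeGroup.of (.inr (i, signChange k i (if Odd (k i) then ε else !ε))) * y) = _
    rw [← signChange_apply, signChange_signChange]
    rfl

/-- The sign of a word in the edges of `X_{1/2}`: whether its lifts to `X_{1/4}` preserve signs. -/
def wordSign : FreeGroup (Fin 3 ⊕ Fin 3) →* ℤˣ :=
  FreeGroup.lift fun e => match e with
    | .inl _ => -1
    | .inr i => if Odd (k i) then 1 else -1

/-- The sign of a vertex of `X_{1/4}` as a unit. -/
def boolSign (ε : Bool) : ℤˣ := if ε then 1 else -1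

theorem boolSign_injective : Function.Injective boolSign := by decide

theorem boolSign_mul_wordSign {u w : Fin 3 × Bool}
    {x : FreeGroup ((Fin 3 × Bool) ⊕ (Fin 3 × Bool))} (h : (graphX14 k).Connects u w x) :
    boolSign u.2 * wordSign k ((mapX14X12 k).onWord x) = boolSign w.2 := by
  have := h.intertwine (fun u => boolSign u.2) ((wordSign k).comp (mapX14X12 k).onWord) 1 ?_
  · simpa using this
  rintro (⟨i, ε⟩ | ⟨i, ε⟩)
  · rw [MonoidHom.comp_apply, mapX14X12_onWord_inl, wordSign, FreeGroup.lift_apply_of]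
    cases ε <;> rfl
  · rw [MonoidHom.comp_apply, mapX14X12_onWord_inr, wordSign, FreeGroup.lift_apply_of]
    by_cases hi : Odd (k i) <;> cases ε <;> simp [hi, graphX14, boolSign]

/-- Path lifting for the covering. -/
theorem exists_lift_graphX14 {u w : Fin 3} {x : FreeGroup (Fin 3 ⊕ Fin 3)}
    (h : graphX12.Connects u w x) :
    ∀ ε, ∃ ε' y, (graphX14 k).Connects (u, ε) (w, ε') y ∧ (mapX14X12 k).onWord y = x := by
  refine h.induction (motive := fun u w x => ∀ ε, ∃ ε' y,
    (graphX14 k).Connects (u, ε) (w, ε') y ∧ (mapX14X12 k).onWord y = x)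
    (fun u ε => ⟨ε, 1, .refl _ _, map_one _⟩) ?_ ?_
  · rintro (i | i) w x ih ε
    · obtain ⟨ε', y, hy, rfl⟩ := ih (!ε)
      refine ⟨ε', _, (Connects.of (graphX14 k) (.inl (i, ε))).mul hy, ?_⟩
      rw [map_mul, mapX14X12_onWord_inl]
    · obtain ⟨ε', y, hy, rfl⟩ := ih (if Odd (k i) then ε else !ε)
      refine ⟨ε', _, (Connects.of (graphX14 k) (.inr (i, ε))).mul hy, ?_⟩
      rw [map_mul, mapX14X12_onWord_inr]
  · rintro (i | i) w x ih ε
    · obtain ⟨ε', y, hy, rfl⟩ := ih (!ε)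
      have he := (Connects.of (graphX14 k) (.inl (i, !ε))).inv
      refine ⟨ε', (FreeGroup.of (.inl (i, !ε)))⁻¹ * y, Connects.mul ?_ hy, ?_⟩
      · have ht : (graphX14 k).tgt (.inl (i, !ε)) = (i + 1, ε) := by
          change (i + 1, !!ε) = _
          rw [Bool.not_not]
        rw [ht] at he
        exact he
      · rw [map_mul, map_inv, mapX14X12_onWord_inl]
    · obtain ⟨ε', y, hy, rfl⟩ := ih (signChange k i ε)
      have he := (Connects.of (graphX14 k) (.inr (i, signChange k i ε))).inv
      refine ⟨ε', (FreeGroup.of (.inr (i, signChange k i ε)))⁻¹ * y, Connects.mul ?_ hy, ?_⟩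
      · have ht : (graphX14 k).tgt (.inr (i, signChange k i ε)) = (i, ε) := by
          change (i, if Odd (k i) then signChange k i ε else !signChange k i ε) = _
          rw [← signChange_apply, signChange_signChange]
        rw [ht] at he
        exact he
      · rw [map_mul, map_inv, mapX14X12_onWord_inr]

/-- The sign homomorphism of `B`. -/
def groupBSign (v : Fin 3 × Bool) : groupB v →* ℤˣ :=
  (wordSign k).comp (graphX12.pi1 v.1).subtype

theorem range_mapCB (v : Fin 3 × Bool) : (mapCB k v).range = (groupBSign k v).ker := by
  apply le_antisymm
  · rintro _ ⟨x, rfl⟩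
    exact mul_eq_left.mp (boolSign_mul_wordSign k x.2)
  · rintro ⟨x, hx⟩ h
    obtain ⟨ε, y, hy, rfl⟩ := exists_lift_graphX14 k hx v.2
    have hs := boolSign_mul_wordSign k hy
    have h' : wordSign k ((mapX14X12 k).onWord y) = 1 := h
    rw [h', mul_one] at hs
    obtain rfl := boolSign_injective hs
    exact ⟨⟨y, hy⟩, rfl⟩

theorem groupBSign_surjective (v : Fin 3 × Bool) : Function.Surjective (groupBSign k v) := by
  -- The triangle of edges of the first kind changes the sign three times.
  have hloop := connects_cyclePath (Γ := graphX12) (next := next12) (fun _ => rfl) (fun _ => rfl)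
    v.1 3
  have h3 : ∀ u, next12^[3] u = u := by decide
  rw [h3] at hloop
  have hs : groupBSign k v ⟨_, hloop⟩ = -1 := by
    change wordSign k (cyclePath next12 v.1 3) = -1
    simp [cyclePath, wordSign]
  intro u
  rcases Int.units_eq_one_or u with rfl | rfl
  · exact ⟨1, map_one _⟩
  · exact ⟨_, hs⟩

theorem index_range_mapCB (v : Fin 3 × Bool) : (mapCB k v).range.index = 2 := by
  rw [range_mapCB, Subgroup.index_ker, MonoidHom.range_eq_top.mpr (groupBSign_surjective k v)]
  simp

end DoubleCover

/-! ### Injectivity of the map to the free group on the loops -/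

open OrGraph

section Odometer

variable {F : Type*} [Group F]

/-- On each of the two copies of `{0, …, n - 1}`, the step `z ↦ z - 1` with holonomy `h` in passing
from `0` to `n - 1`. -/
def odometer (n : ℕ) (h : Bool → F) : Equiv.Perm ((Bool × ℕ) × F) where
  toFun x := if x.1.2 = 0 then ((x.1.1, n - 1), h x.1.1 * x.2)
    else if x.1.2 < n then ((x.1.1, x.1.2 - 1), x.2) else x
  invFun x := if x.1.2 = n - 1 then ((x.1.1, 0), (h x.1.1)⁻¹ * x.2)
    else if x.1.2 < n - 1 then ((x.1.1, x.1.2 + 1), x.2) else x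
  left_inv := by
    rintro ⟨⟨b, z⟩, w⟩
    by_cases hz : z = 0
    · simp [hz]
    · by_cases hn : z < n
      · have h1 : z - 1 ≠ n - 1 := by omega
        have h2 : z - 1 < n - 1 := by omega
        have h3 : z - 1 + 1 = z := by omega
        simp [hz, hn, h1, h2, h3]
      · have h1 : z ≠ n - 1 := by omega
        have h2 : ¬ z < n - 1 := by omega
        simp [hz, hn, h1, h2]
  right_inv := by
    rintro ⟨⟨b, z⟩, w⟩
    by_cases hz : z = n - 1
    · simp [hz]
    · by_cases hn : z < n - 1
      · have h1 : z + 1 < n := by omega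
        simp [hz, hn, h1]
      · have h1 : z ≠ 0 := by omega
        have h2 : ¬ z < n := by omega
        simp [hz, hn, h1, h2]

variable {n : ℕ} {h : Bool → F}

theorem odometer_zero (b : Bool) (w : F) :
    odometer n h ((b, 0), w) = ((b, n - 1), h b * w) := by
  simp [odometer]

theorem odometer_pow_of_le {d z : ℕ} (hd : d ≤ z) (hz : z < n) (b : Bool) (w : F) :
    (odometer n h ^ d) ((b, z), w) = ((b, z - d), w) := by
  induction d with
  | zero => rfl
  | succ d ih =>
    rw [pow_succ', Equiv.Perm.mul_apply, ih (by omega)]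
    exact (if_neg (by simp; omega)).trans (if_pos (by simp; omega))

theorem odometer_pow_zero {d : ℕ} (hd : 1 ≤ d) (hn : d ≤ n) (b : Bool) (w : F) :
    (odometer n h ^ d) ((b, 0), w) = ((b, n - d), h b * w) := by
  obtain ⟨d, rfl⟩ := Nat.exists_eq_add_of_le' hd
  rw [pow_succ, Equiv.Perm.mul_apply, odometer_zero, odometer_pow_of_le (by omega) (by omega)]
  congr 2
  omega

/-- A change of gauge: three points are moved to prescribed places, each with its own translation of
the fibre. -/
theorem exists_relabel {S : Type*} {q B : Fin 3 → S} (hq : Function.Injective q)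
    (hB : Function.Injective B) (r : Fin 3 → F) :
    ∃ Ψ : Equiv.Perm (S × F), ∀ p w, Ψ (q p, r p * w) = (B p, w) := by
  obtain ⟨σ, hσ⟩ := Equiv.Perm.exists_extending_pair q B hq hB
  refine ⟨Equiv.prodShear σ fun s => Equiv.mulLeft (Function.extend q r 1 s)⁻¹, fun p w => ?_⟩
  change (σ (q p), (Function.extend q r 1 (q p))⁻¹ * (r p * w)) = _
  rw [hσ, hq.extend_apply, inv_mul_cancel_left]

theorem conj_pow_apply {X : Type*} (Ψ π : Equiv.Perm X) (d : ℕ) {x y x' y' : X} (hx : Ψ x' = x)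
    (hy : Ψ y' = y) (h : (π ^ d) x' = y') : ((Ψ * π * Ψ⁻¹) ^ d) x = y := by
  rw [conj_pow, Equiv.Perm.mul_apply, Equiv.Perm.mul_apply, ← hx, ← hy, ← h]
  congr 2
  exact Ψ.symm_apply_apply _

/-- The arcs `B 1 → B 2 → B 0 → B 1`, of lengths `1`, `m`, `m`, close up to a cycle of length `2m +
1`. The gauge pushes all holonomy into the passage from `0` to `2m`. -/
theorem exists_perm_odd {B : Fin 3 → Bool × ℕ} (hB : Function.Injective B) {m : ℕ} (hm : 1 ≤ m)
    (h₁ h₂ h₃ : F) : ∃ π : Equiv.Perm ((Bool × ℕ) × F), ∀ w,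
      (π ^ 1) (B 1, w) = (B 2, h₁ * w) ∧ (π ^ m) (B 0, w) = (B 1, h₂ * w) ∧
      (π ^ m) (B 2, w) = (B 0, h₃ * w) := by
  have hq : Function.Injective ![(true, m + 1), (true, 1), (true, 0)] := by
    have h0 : m ≠ 0 := by omega
    intro a b
    fin_cases a <;> fin_cases b <;> simp [h0]
  obtain ⟨Ψ, hΨ⟩ := exists_relabel hq hB ![h₁ * h₂, h₁, 1]
  refine ⟨Ψ * odometer (2 * m + 1) (fun _ => h₁ * h₂ * h₃) * Ψ⁻¹, fun w => ⟨?_, ?_, ?_⟩⟩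
  · refine conj_pow_apply _ _ _ (hΨ 1 w) (hΨ 2 _) ?_
    exact (odometer_pow_of_le le_rfl (by omega) _ _).trans (by simp)
  · refine conj_pow_apply _ _ _ (hΨ 0 w) (hΨ 1 _) ?_
    exact (odometer_pow_of_le (z := m + 1) (by omega) (by omega) _ _).trans (by simp [mul_assoc])
  · refine conj_pow_apply _ _ _ (hΨ 2 w) (hΨ 0 _) ?_
    refine (odometer_pow_zero (by omega) (by omega) _ _).trans ?_
    simp [mul_assoc, show 2 * m + 1 - m = m + 1 by omega]

/-- Two cycles of length `m`: one through `B 0` alone, the other made of `B 1 → B 2` of length `1`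
and `B 2 → B 1` of length `m - 1`. For `m = 1` the latter two points would coincide on the cycle. -/
theorem exists_perm_even {B : Fin 3 → Bool × ℕ} (hB : Function.Injective B) {m : ℕ} (hm : 2 ≤ m)
    (h₁ h₂ h₃ : F) : ∃ π : Equiv.Perm ((Bool × ℕ) × F), ∀ w,
      (π ^ 1) (B 1, w) = (B 2, h₁ * w) ∧ (π ^ m) (B 0, w) = (B 0, h₂ * w) ∧
      (π ^ (m - 1)) (B 2, w) = (B 1, h₃ * w) := by
  have hq : Function.Injective ![(true, 0), (false, 1), (false, 0)] := by decide
  obtain ⟨Ψ, hΨ⟩ := exists_relabel hq hB ![1, h₁, 1]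
  refine ⟨Ψ * odometer m (fun b => if b then h₂ else h₁ * h₃) * Ψ⁻¹, fun w => ⟨?_, ?_, ?_⟩⟩
  · refine conj_pow_apply _ _ _ (hΨ 1 w) (hΨ 2 _) ?_
    exact (odometer_pow_of_le le_rfl (by omega) _ _).trans (by simp)
  · refine conj_pow_apply _ _ _ (hΨ 0 w) (hΨ 0 _) ?_
    exact (odometer_pow_zero (by omega) (by omega) _ _).trans (by simp)
  · refine conj_pow_apply _ _ _ (hΨ 2 w) (hΨ 1 _) ?_
    refine (odometer_pow_zero (by omega) (by omega) _ _).trans ?_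
    simp [mul_assoc, show m - (m - 1) = 1 by omega]

end Odometer

/-! ### Contracting the collapsed edges -/

section Immersion

variable (k : Fin 3 → ℕ)

theorem mapX14X0_onWord_of (e : (Fin 3 × Bool) ⊕ (Fin 3 × Bool)) :
    (mapX14X0 k).onWord (FreeGroup.of e) = FreeGroup.of (edgeColour e) ^ edgeDegree k e := by
  refine (PathMap.onWord_of _ _).trans ?_
  change FreeGroup.mk (List.replicate _ _) = _
  induction edgeDegree k e with
  | zero => exact FreeGroup.one_eq_mk.symm
  | succ d ih => rw [pow_succ', ← ih, List.replicate_succ]; rfl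

/-- The image of a vertex when the collapsed edges of `X_{1/4}` are contracted. -/
def contract (u : Fin 3 × Bool) : Fin 3 := if u.2 then u.1 else u.1 + 2

/-- The path to a vertex of `X_{1/4}` in the union of the collapsed edges. -/
def contractPath (u : Fin 3 × Bool) : FreeGroup ((Fin 3 × Bool) ⊕ (Fin 3 × Bool)) :=
  if u.2 then 1 else FreeGroup.of (.inl (u.1 + 2, true))

theorem exists_perm_colour (hk : ∀ i, 3 ≤ k i) (i : Fin 3) :
    ∃ π : Equiv.Perm ((Bool × ℕ) × FreeGroup ((Fin 3 × Bool) ⊕ (Fin 3 × Bool))),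
      ∀ e, edgeColour e = i → ∀ y, (π ^ edgeDegree k e)
        ((true, (contract ((graphX14 k).tgt e)).val), contractPath ((graphX14 k).tgt e) * y) =
        ((true, (contract ((graphX14 k).src e)).val),
          contractPath ((graphX14 k).src e) * (FreeGroup.of e * y)) := by
  have hB : Function.Injective fun p : Fin 3 => (true, ((p + i : Fin 3) : ℕ)) := fun a b h =>
    add_right_cancel (Fin.ext (congrArg Prod.snd h))
  have h3 : ∀ i : Fin 3, i + 1 + 2 = i := by decide
  -- The edge as seen after contraction: its ends are joined to the contracted vertices through
  -- collapsed edges.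
  let hol := fun e => contractPath ((graphX14 k).src e) * FreeGroup.of e *
    (contractPath ((graphX14 k).tgt e))⁻¹
  have hki := hk i
  by_cases hi : Odd (k i)
  · obtain ⟨π, hπ⟩ := exists_perm_odd hB (m := k i / 2) (by omega)
      (hol (.inl (i, false))) (hol (.inr (i, true))) (hol (.inr (i, false)))
    refine ⟨π, ?_⟩
    rintro (⟨j, _ | _⟩ | ⟨j, _ | _⟩) (rfl : j = i) y
    · have := (hπ (contractPath ((graphX14 k).tgt (.inl (j, false))) * y)).1
      simpa [hol, graphX14, contract, edgeDegree, mul_assoc, add_comm] using this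
    · simp [graphX14, contract, contractPath, edgeDegree, h3]
    · have := (hπ (contractPath ((graphX14 k).tgt (.inr (j, false))) * y)).2.2
      simpa [hol, graphX14, contract, edgeDegree, mul_assoc, add_comm, hi, h3] using this
    · have := (hπ (contractPath ((graphX14 k).tgt (.inr (j, true))) * y)).2.1
      simpa [hol, graphX14, contract, edgeDegree, mul_assoc, add_comm, hi, h3] using this
  · have hi' := Nat.not_odd_iff.mp hi
    obtain ⟨π, hπ⟩ := exists_perm_even hB (m := k i / 2) (by omega)
      (hol (.inl (i, false))) (hol (.inr (i, false))) (hol (.inr (i, true)))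
    refine ⟨π, ?_⟩
    rintro (⟨j, _ | _⟩ | ⟨j, _ | _⟩) (rfl : j = i) y
    · have := (hπ (contractPath ((graphX14 k).tgt (.inl (j, false))) * y)).1
      simpa [hol, graphX14, contract, edgeDegree, mul_assoc, add_comm] using this
    · simp [graphX14, contract, contractPath, edgeDegree, h3]
    · have := (hπ (contractPath ((graphX14 k).tgt (.inr (j, false))) * y)).2.1
      simpa [hol, graphX14, contract, edgeDegree, mul_assoc, add_comm, hi, h3] using this
    · have := (hπ (contractPath ((graphX14 k).tgt (.inr (j, true))) * y)).2.2
      simpa [hol, graphX14, contract, edgeDegree, mul_assoc, add_comm, hi, h3] using this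

theorem mapCA_injective (hk : ∀ i, 3 ≤ k i) (v : Fin 3 × Bool) :
    Function.Injective (mapCA k v) := by
  choose π hπ using exists_perm_colour k hk
  refine (mapX14X0 k).pi1Map_injective (FreeGroup.lift π)
    (fun u y => ((true, (contract u).val), contractPath u * y)) (fun e y => ?_) fun x y h =>
      mul_left_cancel (congrArg Prod.snd h)
  rw [mapX14X0_onWord_of, map_pow, FreeGroup.lift_apply_of]
  exact hπ _ e rfl y

end Immersion

/-! ### The splitting of the Artin group -/

open OrGraph

/-! ### Artin relations in terms of the product `ab` -/

section AltWord

variable {G H : Type*} [Group G] [Group H]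

theorem map_altWord (f : G →* H) (a b : G) (n : ℕ) :
    f (altWord a b n) = altWord (f a) (f b) n := by
  induction n generalizing a b with
  | zero => exact map_one f
  | succ n ih => rw [altWord, altWord, map_mul, ih]

theorem altWord_two_mul (a b : G) (m : ℕ) : altWord a b (2 * m) = (a * b) ^ m := by
  induction m with
  | zero => exact (pow_zero _).symm
  | succ m ih =>
    rw [show 2 * (m + 1) = 2 * m + 1 + 1 by ring, altWord, altWord, ih, pow_succ', mul_assoc]

theorem altWord_two_mul_add_one (a b : G) (m : ℕ) :
    altWord a b (2 * m + 1) = (a * b) ^ m * a := by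
  induction m with
  | zero => simp [altWord]
  | succ m ih =>
    rw [show 2 * (m + 1) + 1 = 2 * m + 1 + 1 + 1 by ring, altWord, altWord, ih, pow_succ',
      mul_assoc, mul_assoc]

theorem altWord_eq_iff_of_odd {n : ℕ} (hn : Odd n) (a b : G) :
    altWord a b n = altWord b a n ↔ b * (a * b) ^ (n / 2) = (a * b) ^ (n / 2) * a := by
  obtain ⟨m, rfl⟩ := hn
  rw [altWord_two_mul_add_one, show altWord b a (2 * m + 1) = b * altWord a b (2 * m) from rfl,
    altWord_two_mul, show (2 * m + 1) / 2 = m by omega, eq_comm]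

theorem altWord_eq_iff_of_even {n : ℕ} (hn : ¬ Odd n) (h0 : n ≠ 0) (a b : G) :
    altWord a b n = altWord b a n ↔
      b * (a * b) ^ (n / 2 - 1) * a = (a * b) ^ (n / 2) := by
  obtain ⟨m, hm⟩ := Nat.not_odd_iff_even.mp hn
  obtain ⟨m, rfl⟩ := Nat.exists_eq_succ_of_ne_zero (show m ≠ 0 by omega)
  obtain rfl : n = 2 * (m + 1) := by omega
  rw [altWord_two_mul, show 2 * (m + 1) = 2 * m + 1 + 1 by ring, altWord, altWord_two_mul_add_one,
    show (2 * m + 1 + 1) / 2 = m + 1 by omega, Nat.add_sub_cancel, mul_assoc, eq_comm]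

end AltWord

/-- A representation of the mapping cylinder of `X₀ ← X_{1/4} → X_{1/2}` in `G`: the vertices of
`X_{1/4}` stand for the segments that join their images. -/
structure CylinderRep (k : Fin 3 → ℕ) (G : Type*) [Group G] where
  segment : Fin 3 × Bool → G
  edge : FreeGroup (Fin 3 ⊕ Fin 3) →* G
  loop : FreeGroup (Fin 3) →* G
  square : ∀ e, segment ((graphX14 k).src e) * edge ((mapX14X12 k).onWord (FreeGroup.of e)) =
    loop ((mapX14X0 k).onWord (FreeGroup.of e)) * segment ((graphX14 k).tgt e)

/-! ### Representations of the mapping cylinder -/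

namespace CylinderRep

variable {k : Fin 3 → ℕ} {G : Type*} [Group G] (R : CylinderRep k G)

theorem square_of_connects {u w : Fin 3 × Bool}
    {x : FreeGroup ((Fin 3 × Bool) ⊕ (Fin 3 × Bool))} (h : (graphX14 k).Connects u w x) :
    R.segment u * R.edge ((mapX14X12 k).onWord x) =
      R.loop ((mapX14X0 k).onWord x) * R.segment w :=
  h.intertwine R.segment (R.edge.comp (mapX14X12 k).onWord) (R.loop.comp (mapX14X0 k).onWord)
    R.square

theorem square_inl_true (i : Fin 3) :
    R.segment (i, true) * R.edge (FreeGroup.of (.inl i)) = R.segment (i + 1, false) := by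
  have := R.square (.inl (i, true))
  rw [mapX14X12_onWord_inl, mapX14X0_onWord_of] at this
  simpa [edgeDegree, edgeColour, graphX14] using this

theorem square_inl_false (i : Fin 3) :
    R.segment (i, false) * R.edge (FreeGroup.of (.inl i)) =
      R.loop (FreeGroup.of i) * R.segment (i + 1, true) := by
  have := R.square (.inl (i, false))
  rw [mapX14X12_onWord_inl, mapX14X0_onWord_of] at this
  simpa [edgeDegree, edgeColour, graphX14] using this

theorem square_inr (i : Fin 3) (ε : Bool) :
    R.segment (i + 1, ε) * R.edge (FreeGroup.of (.inr i)) =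
      R.loop (FreeGroup.of i) ^ edgeDegree k (.inr (i, ε)) *
        R.segment (i, if Odd (k i) then ε else !ε) := by
  have := R.square (.inr (i, ε))
  rwa [mapX14X12_onWord_inr, mapX14X0_onWord_of, map_pow] at this

/-- The image of a generator of the Artin group. -/
def gen (i : Fin 3) : G := R.segment (i, false) * (R.segment (i, true))⁻¹

theorem gen_mul_gen (i : Fin 3) : R.gen i * R.gen (i + 1) = R.loop (FreeGroup.of i) := by
  rw [gen, gen, ← square_inl_true, mul_assoc, mul_assoc, inv_mul_cancel_left, ← mul_assoc,
    square_inl_false, mul_inv_cancel_right]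

/-- The two lifts of an edge of the second kind give two expressions for its value; equating them is
the Artin relation. -/
theorem altWord_gen (hk : ∀ i, 3 ≤ k i) (i : Fin 3) :
    altWord (R.gen i) (R.gen (i + 1)) (k i) = altWord (R.gen (i + 1)) (R.gen i) (k i) := by
  have ht := R.square_inr i true
  have hf := R.square_inr i false
  by_cases hi : Odd (k i)
  · rw [altWord_eq_iff_of_odd hi, gen_mul_gen]
    simp only [hi, if_true, edgeDegree] at ht hf
    rw [gen, gen, ← mul_assoc (R.loop _ ^ _), ← hf, eq_mul_inv_of_mul_eq ht.symm]
    group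
  · have hki := hk i
    rw [altWord_eq_iff_of_even hi (by omega), gen_mul_gen]
    simp only [hi, if_false, if_true, edgeDegree, Bool.not_true, Bool.not_false,
      Bool.false_eq_true] at ht hf
    rw [eq_mul_inv_of_mul_eq ht.symm, eq_mul_inv_of_mul_eq hf.symm]
    simp [gen, mul_assoc]

/-- The homomorphism of the Artin group given by a representation of the mapping cylinder. -/
def artinHom (hk : ∀ i, 3 ≤ k i) : ArtinTriangle k →* G :=
  PresentedGroup.toGroup (f := R.gen) (by
    rintro _ ⟨i, rfl⟩
    rw [map_mul, map_inv, map_altWord, map_altWord, FreeGroup.lift_apply_of,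
      FreeGroup.lift_apply_of, R.altWord_gen hk, mul_inv_cancel])

theorem artinHom_of (hk : ∀ i, 3 ≤ k i) (i : Fin 3) :
    R.artinHom hk (PresentedGroup.of i) = R.gen i :=
  PresentedGroup.toGroup.of _

/-- The homomorphism of the amalgam given by a representation of the mapping cylinder in which the
segment at the base point is trivial. -/
def amalgamHom {v : Fin 3 × Bool} (hv : R.segment v = 1) :
    Amalgam (mapCA k v) (mapCB k v) →* G :=
  Amalgam.lift (R.loop.comp groupAEquiv.toMonoidHom) (R.edge.comp (graphX12.pi1 v.1).subtype)
    fun c => by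
      have := R.square_of_connects c.2
      rw [hv, one_mul, mul_one] at this
      exact this.symm

theorem amalgamHom_inl {v : Fin 3 × Bool} (hv : R.segment v = 1) (a : groupA) :
    R.amalgamHom hv (Amalgam.inl _ _ a) = R.loop (groupAEquiv a) :=
  Amalgam.lift_inl _ _ _ _

theorem amalgamHom_inr {v : Fin 3 × Bool} (hv : R.segment v = 1) (b : groupB v) :
    R.amalgamHom hv (Amalgam.inr _ _ b) = R.edge b :=
  Amalgam.lift_inr _ _ _ _

/-- The representation of the mapping cylinder in the Artin group in which the segments of sign `δ`
are trivial. -/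
def artin (hk : ∀ i, 3 ≤ k i) (δ : Bool) : CylinderRep k (ArtinTriangle k) :=
  let a : Fin 3 → ArtinTriangle k := PresentedGroup.of
  -- The segment at `i₊`; the one at `i₋` is `a i * s₀ i`, so the quotient is `a i` for either `δ`.
  let s₀ : Fin 3 → ArtinTriangle k := fun i => if δ then 1 else (a i)⁻¹
  { segment := fun u => if u.2 then s₀ u.1 else a u.1 * s₀ u.1
    edge := FreeGroup.lift fun e => match e with
      | .inl i => (s₀ i)⁻¹ * (a (i + 1) * s₀ (i + 1))
      | .inr i => if Odd (k i) then (s₀ (i + 1))⁻¹ * (a i * a (i + 1)) ^ (k i / 2) * s₀ i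
          else (a (i + 1) * s₀ (i + 1))⁻¹ * (a i * a (i + 1)) ^ (k i / 2) * s₀ i
    loop := FreeGroup.lift fun i => a i * a (i + 1)
    square := by
      have hrel : ∀ i, altWord (a i) (a (i + 1)) (k i) = altWord (a (i + 1)) (a i) (k i) := by
        intro i
        have : PresentedGroup.mk (artinRelators k) _ = 1 :=
          PresentedGroup.one_of_mem ⟨i, rfl⟩
        rw [map_mul, map_inv, map_altWord, map_altWord, mul_inv_eq_one] at this
        exact this
      rintro (⟨i, _ | _⟩ | ⟨i, _ | _⟩)
      · rw [mapX14X12_onWord_inl, mapX14X0_onWord_of, map_pow, FreeGroup.lift_apply_of,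
          FreeGroup.lift_apply_of]
        simp [graphX14, edgeDegree, edgeColour, mul_assoc]
      · rw [mapX14X12_onWord_inl, mapX14X0_onWord_of, map_pow, FreeGroup.lift_apply_of]
        simp [graphX14, edgeDegree]
      · rw [mapX14X12_onWord_inr, mapX14X0_onWord_of, map_pow, FreeGroup.lift_apply_of,
          FreeGroup.lift_apply_of]
        by_cases hi : Odd (k i)
        · have := (altWord_eq_iff_of_odd hi _ _).mp (hrel i)
          simp only [graphX14, edgeDegree, edgeColour, hi, if_true, Bool.false_eq_true, if_false]
          rw [← mul_assoc _ (a i) (s₀ i), ← this]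
          group
        · simp [graphX14, edgeDegree, edgeColour, hi, mul_assoc]
      · rw [mapX14X12_onWord_inr, mapX14X0_onWord_of, map_pow, FreeGroup.lift_apply_of,
          FreeGroup.lift_apply_of]
        by_cases hi : Odd (k i)
        · simp [graphX14, edgeDegree, edgeColour, hi, mul_assoc]
        · have hki := hk i
          have := (altWord_eq_iff_of_even hi (by omega) _ _).mp (hrel i)
          simp [graphX14, edgeDegree, edgeColour, hi, ← this, mul_assoc] }

theorem artin_segment (hk : ∀ i, 3 ≤ k i) (δ : Bool) (i : Fin 3) :
    (artin hk δ).segment (i, δ) = 1 := by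
  cases δ <;> simp [artin]

theorem artin_gen (hk : ∀ i, 3 ≤ k i) (δ : Bool) (i : Fin 3) :
    (artin hk δ).gen i = PresentedGroup.of i := by
  cases δ <;> simp [gen, artin]

/-- A path in `X_{1/4}` from `v` to a vertex. -/
def path14 (v u : Fin 3 × Bool) : FreeGroup ((Fin 3 × Bool) ⊕ (Fin 3 × Bool)) :=
  treePath (exists_iterate_next14 v) u

theorem connects_path14 (k : Fin 3 → ℕ) (v u : Fin 3 × Bool) :
    (graphX14 k).Connects v u (path14 v u) :=
  connects_treePath _ (fun _ => rfl) (fun _ => rfl) u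

/-- A path in `X_{1/2}` from `v` to a vertex. -/
def path12 (v u : Fin 3) : FreeGroup (Fin 3 ⊕ Fin 3) := treePath (exists_iterate_next12 v) u

theorem connects_path12 (v u : Fin 3) : graphX12.Connects v u (path12 v u) :=
  connects_treePath _ (fun _ => rfl) (fun _ => rfl) u

theorem path12_self (v : Fin 3) : path12 v v = 1 := treePath_base _

theorem path14_self (v : Fin 3 × Bool) : path14 v v = 1 := treePath_base _

/-- The loops of `X₀` in the amalgam. -/
def amalgamLoop (k : Fin 3 → ℕ) (v : Fin 3 × Bool) :
    FreeGroup (Fin 3) →* Amalgam (mapCA k v) (mapCB k v) :=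
  (Amalgam.inl _ _).comp groupAEquiv.symm.toMonoidHom

/-- The edges of `X_{1/2}` in the amalgam. -/
def amalgamEdge (k : Fin 3 → ℕ) (v : Fin 3 × Bool) :
    FreeGroup (Fin 3 ⊕ Fin 3) →* Amalgam (mapCA k v) (mapCB k v) :=
  (Amalgam.inr _ _).comp (retraction (path12 v.1) (connects_path12 v.1))

theorem amalgamEdge_coe (k : Fin 3 → ℕ) (v : Fin 3 × Bool) (b : groupB v) :
    amalgamEdge k v b = Amalgam.inr _ _ b :=
  congrArg (Amalgam.inr _ _) (retraction_coe _ (connects_path12 v.1) (path12_self v.1) b)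

theorem amalgamEdge_eq_amalgamLoop (k : Fin 3 → ℕ) (v : Fin 3 × Bool) (c : groupC k v) :
    amalgamEdge k v ((mapX14X12 k).onWord c) = amalgamLoop k v ((mapX14X0 k).onWord c) :=
  (amalgamEdge_coe k v (mapCB k v c)).trans ((Amalgam.inl_eq_inr c).symm.trans
    (congrArg _ (groupAEquiv.symm_apply_apply (mapCA k v c)).symm))

/-- The representation of the mapping cylinder in the amalgam. -/
def amalgam (k : Fin 3 → ℕ) (v : Fin 3 × Bool) :
    CylinderRep k (Amalgam (mapCA k v) (mapCB k v)) where
  -- The trivial segment at `v`, transported along a path to `u`.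
  segment u := (amalgamLoop k v ((mapX14X0 k).onWord (path14 v u)))⁻¹ *
    amalgamEdge k v ((mapX14X12 k).onWord (path14 v u))
  edge := amalgamEdge k v
  loop := amalgamLoop k v
  square e := by
    have := amalgamEdge_eq_amalgamLoop k v
      ⟨_, ((connects_path14 k v _).mul (.of _ e)).mul (connects_path14 k v _).inv⟩
    simp only [map_mul, map_inv] at this
    rw [mul_inv_eq_iff_eq_mul] at this
    rw [mul_assoc, this]
    group

theorem amalgam_segment_base (k : Fin 3 → ℕ) (v : Fin 3 × Bool) : (amalgam k v).segment v = 1 := by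
  simp [amalgam, path14_self]

/-- The retraction onto `B` trivialises the tree paths, so segments return only up to a factor
depending on the vertex of `X_{1/2}`. This factor cancels in `gen`. -/
theorem amalgamHom_segment {v : Fin 3 × Bool} (hv : R.segment v = 1) (u : Fin 3 × Bool) :
    R.amalgamHom hv ((amalgam k v).segment u) =
      R.segment u * (R.edge (path12 v.1 u.1))⁻¹ := by
  have h := R.square_of_connects (connects_path14 k v u)
  rw [hv, one_mul] at h
  have hl : R.amalgamHom hv (amalgamLoop k v ((mapX14X0 k).onWord (path14 v u))) =
      R.loop ((mapX14X0 k).onWord (path14 v u)) :=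
    (R.amalgamHom_inl hv _).trans (congrArg _ (groupAEquiv.apply_symm_apply _))
  have he : R.amalgamHom hv (amalgamEdge k v ((mapX14X12 k).onWord (path14 v u))) =
      R.edge ((mapX14X12 k).onWord (path14 v u)) * (R.edge (path12 v.1 u.1))⁻¹ := by
    refine (R.amalgamHom_inr hv _).trans ?_
    rw [retraction_of_connects _ _ ((connects_path14 k v u).map (mapX14X12 k)), map_mul, map_mul,
      map_inv]
    change R.edge (path12 v.1 v.1) * _ * _ = _
    rw [path12_self, map_one, one_mul]
    rfl
  change R.amalgamHom hv (_⁻¹ * _) = _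
  rw [map_mul, map_inv, hl, he, h]
  group

theorem amalgamHom_gen {v : Fin 3 × Bool} (hv : R.segment v = 1) (i : Fin 3) :
    R.amalgamHom hv ((amalgam k v).gen i) = R.gen i := by
  rw [gen, map_mul, map_inv, amalgamHom_segment, amalgamHom_segment, gen]
  group

theorem artinHom_gen_artin (hk : ∀ i, 3 ≤ k i) (δ : Bool) (i : Fin 3) :
    R.artinHom hk ((artin hk δ).gen i) = R.gen i := by
  rw [artin_gen, artinHom_of]

theorem artinHom_segment (hk : ∀ i, 3 ≤ k i) (δ : Bool) (u : Fin 3 × Bool) :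
    R.artinHom hk ((artin hk δ).segment u) = R.segment u * (R.segment (u.1, δ))⁻¹ := by
  obtain ⟨i, ε⟩ := u
  have h := R.artinHom_gen_artin hk δ i
  have h1 := artin_segment hk δ i
  rw [gen, map_mul, map_inv] at h
  cases δ <;> cases ε <;> simp_all [gen]
  rw [inv_eq_iff_eq_inv.mp h]
  simp

theorem artinHom_loop (hk : ∀ i, 3 ≤ k i) (δ : Bool) (x : FreeGroup (Fin 3)) :
    R.artinHom hk ((artin hk δ).loop x) = R.loop x := by
  have : (R.artinHom hk).comp (artin hk δ).loop = R.loop := by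
    refine FreeGroup.ext_hom _ _ fun i => ?_
    rw [MonoidHom.comp_apply, ← gen_mul_gen, map_mul, artinHom_gen_artin, artinHom_gen_artin,
      gen_mul_gen]
  exact DFunLike.congr_fun this x

/-- Normalising the segments of sign `δ` conjugates edge values by those segments. On loops at a
vertex whose segment is trivial nothing changes, which is the case needed on `B`. -/
theorem artinHom_edge (hk : ∀ i, 3 ≤ k i) (δ : Bool) {u w : Fin 3}
    {x : FreeGroup (Fin 3 ⊕ Fin 3)} (h : graphX12.Connects u w x) :
    R.segment (u, δ) * R.edge x =
      R.artinHom hk ((artin hk δ).edge x) * R.segment (w, δ) := by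
  refine h.intertwine (fun u => R.segment (u, δ)) R.edge
    ((R.artinHom hk).comp (artin hk δ).edge) fun e => ?_
  have key : ∀ e,
      R.segment (((graphX14 k).src e).1, δ) * R.edge ((mapX14X12 k).onWord (FreeGroup.of e)) =
        R.artinHom hk ((artin hk δ).edge ((mapX14X12 k).onWord (FreeGroup.of e))) *
          R.segment (((graphX14 k).tgt e).1, δ) := by
    intro e
    have h1 := R.square e
    have h2 := congrArg (R.artinHom hk) ((artin hk δ).square e)
    rw [map_mul, map_mul, artinHom_segment, artinHom_segment, artinHom_loop, mul_assoc,
      ← mul_assoc (R.loop _), ← h1, mul_assoc, mul_right_inj, inv_mul_eq_iff_eq_mul] at h2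
    rw [h2]
    group
  rcases e with i | i
  · have := key (.inl (i, true))
    rwa [mapX14X12_onWord_inl] at this
  · have := key (.inr (i, true))
    rwa [mapX14X12_onWord_inr] at this

end CylinderRep

/-- The splitting of the Artin group. -/
def artinSplitting {k : Fin 3 → ℕ} (hk : ∀ i, 3 ≤ k i) (v : Fin 3 × Bool) :
    Amalgam (mapCA k v) (mapCB k v) ≃* ArtinTriangle k :=
  MonoidHom.toMulEquiv
    ((CylinderRep.artin hk v.2).amalgamHom (CylinderRep.artin_segment hk v.2 v.1))
    ((CylinderRep.amalgam k v).artinHom hk)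
    (Amalgam.hom_ext
      (fun a => by
        rw [MonoidHom.comp_apply, CylinderRep.amalgamHom_inl, CylinderRep.artinHom_loop]
        exact congrArg (Amalgam.inl _ _) (groupAEquiv.symm_apply_apply a))
      (fun b => by
        have h := (CylinderRep.amalgam k v).artinHom_edge hk v.2 b.2
        have h1 := CylinderRep.amalgam_segment_base k v
        rw [h1, one_mul, mul_one] at h
        rw [MonoidHom.comp_apply, CylinderRep.amalgamHom_inr, ← h]
        exact CylinderRep.amalgamEdge_coe k v b))
    (PresentedGroup.ext fun i => by
      rw [MonoidHom.comp_apply, CylinderRep.artinHom_of, CylinderRep.amalgamHom_gen,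
        CylinderRep.artin_gen]
      rfl)

theorem artinSplitting_loopA {k : Fin 3 → ℕ} (hk : ∀ i, 3 ≤ k i) (v : Fin 3 × Bool) (i : Fin 3) :
    artinSplitting hk v (Amalgam.inl _ _ (loopA i)) =
      PresentedGroup.of i * PresentedGroup.of (i + 1) := by
  change (CylinderRep.artin hk v.2).amalgamHom (v := v) (CylinderRep.artin_segment hk v.2 v.1)
    (Amalgam.inl _ _ (loopA i)) = _
  rw [CylinderRep.amalgamHom_inl, ← groupAEquiv_symm_of, MulEquiv.apply_symm_apply,
    ← CylinderRep.gen_mul_gen, CylinderRep.artin_gen, CylinderRep.artin_gen]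

theorem mainTheorem7 (M N P : ℕ) (hM : 3 ≤ M) (hN : 3 ≤ N) (hP : 3 ≤ P) (v : Fin 3 × Bool) :
    -- `A ≃ F₃`, `B ≃ F₄`, `C ≃ F₇`, and `C` is a subgroup of `A` and an index two subgroup of `B`
    Nonempty (groupA ≃* FreeGroup (Fin 3)) ∧
    Nonempty (groupB v ≃* FreeGroup (Fin 4)) ∧
    Nonempty (groupC ![M, N, P] v ≃* FreeGroup (Fin 7)) ∧
    Function.Injective (mapCA ![M, N, P] v) ∧
    Function.Injective (mapCB ![M, N, P] v) ∧
    (mapCB ![M, N, P] v).range.index = 2 ∧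
    -- the splitting `A *_C B`, in which `x = ab`, `y = bc`, `z = ca`
    (∃ e : Amalgam (mapCA ![M, N, P] v) (mapCB ![M, N, P] v) ≃* ArtinTriangle ![M, N, P],
      ∀ i : Fin 3, e (Amalgam.inl _ _ (loopA i)) =
        PresentedGroup.of i * PresentedGroup.of (i + 1)) ∧
    -- the index two subgroup isomorphic to the twisted double, for any `g ∈ B - C`
    (∃ H : Subgroup (ArtinTriangle ![M, N, P]), H.index = 2 ∧
      ∀ g : groupB v, g ∉ (mapCB ![M, N, P] v).range →
        ∃ β : groupC ![M, N, P] v ≃* groupC ![M, N, P] v,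
          (∀ h, mapCB ![M, N, P] v (β h) = g⁻¹ * mapCB ![M, N, P] v h * g) ∧
          Nonempty (TwistedDouble (mapCA ![M, N, P] v) β ≃* H)) := by
  have hk : ∀ i, 3 ≤ ![M, N, P] i := by
    intro i
    fin_cases i
    exacts [hM, hN, hP]
  have hχ := range_mapCB ![M, N, P] v
  refine ⟨⟨groupAEquiv⟩, nonempty_groupB_mulEquiv v, nonempty_groupC_mulEquiv _ v,
    mapCA_injective _ hk v, mapCB_injective _ v, index_range_mapCB _ v,
    ⟨artinSplitting hk v, artinSplitting_loopA hk v⟩,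
    -- This `H` is chosen before `g`: only `β` depends on `g`.
    (TwistedDouble.sign (mapCA ![M, N, P] v) hχ).ker.map (artinSplitting hk v).toMonoidHom, ?_,
    fun g hg => ?_⟩
  · refine (Subgroup.index_map_equiv _ (artinSplitting hk v)).trans ?_
    rw [Subgroup.index_ker, MonoidHom.range_eq_top.mpr]
    · simp
    · intro u
      obtain ⟨b, hb⟩ := groupBSign_surjective ![M, N, P] v u
      exact ⟨Amalgam.inr _ _ b, (Amalgam.lift_inr _ _ _ b).trans hb⟩
  · obtain ⟨β, hβ, ⟨e⟩⟩ := TwistedDouble.exists_mulEquiv (f := mapCA ![M, N, P] v)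
      (mapCB_injective _ v) hχ hg
    exact ⟨β, hβ, ⟨e.trans ((artinSplitting hk v).subgroupMap _)⟩⟩
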